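/- Fix $n \ge 1$ and a partition $\lambda = (\lambda_1 \ge \dots \ge \lambda_n \ge 0)$, viewed as a shape with $\lambda_i$ boxes in row $i$. Write $[n] = \{1,\dots,n\}$. *Tuples.* All tuples $\nu = (\nu_1,\dots,\nu_n)$ have entries in $[n]$. Such a tuple is *upper* if $\nu_i \ge i$ for all $i$, and an *upper flag* if moreover $\nu_1\le\dots\le\nu_n$. Let $R\subseteq[n-1]$ with elements $q_1<\dots<q_r$, $q_0:=0$, $q_{r+1}:=n$; the intervals $(q_{h-1},q_h]$ are the *carrels*. A tuple is *$R$-increasing* if it is strictly increasing on each carrel. A permutation $\pi$ of $[n]$ (in one-line notation) is an *$R$-permutation* if it is $R$-increasing; an $R$-permutation is *$R$-312-avoiding* if there are no $h\in[r-1]$ and $a\le q_h<b\le q_{h+1}<c$ with $\pi_a>\pi_b<\pi_c$ and $\pi_a>\pi_c$. A permutation $\sigma$ is *312-avoiding* if there are no $a<b<c$ with $\sigma_a>\sigma_b<\sigma_c$ and $\sigma_a>\sigma_c$. The *$R$-projection* $\bar\sigma$ of $\sigma$ is obtained by sorting the entries on each carrel increasingly. The *rank $R$-tuple* $\Psi_R(\pi)$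 has on the carrel $(q_{h-1},q_h]$, in increasing order, the $q_h-q_{h-1}$ largest elements of $\{\pi_1,\dots,\pi_{q_h}\}$. Put $\Psi:=\Psi_{[n-1]}$. The *critical indices* of an upper tuple $\upsilon$ in the carrel $(q_{h-1},q_h]$ are $x_1>x_2>\dots$, where $x_1=q_h$ and $x_{u}$ is the largest index with $q_{h-1}<x_u<x_{u-1}$ and $\upsilon_{x_{u-1}}-\upsilon_{x_u}>x_{u-1}-x_u$, as long as it exists. An upper $R$-increasing tuple $\gamma$ is a *gapless $R$-tuple* if, for all $h\in[r]$, $\gamma_{q_h}\le\gamma_k$ where $k$ is the leftmost critical index of $\gamma$ in the carrel $(q_h,q_{h+1}]$. *Polynomials.* Let $R_\lambda\subseteq[n-1]$ be the set of column lengths of $\lambda$ that are less than $n$; the prefix or subscript $\lambda$ means $R=R_\lambda$. Let $\mathcal T_\lambda$ be the set of semistandard tableaux of shape $\lambda$ with values in $[n]$, ordered entrywise, and let $x^{\Theta(T)}=\prod_{k} x_k^{\#\{k\text{'s in }T\}}$. For an upper tuple $\beta$ let $s_\lambda(\beta;x)=\sum x^{\Theta(T)}$ over the $T\in\mathcal T_\lambda$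 whose values in row $i$ are at most $\beta_i$ for all $i$. For a permutation $\sigma$ let $Y_\lambda(\sigma)$ be the tableau whose columns of length $q$ have the value set $\{\sigma_1,\dots,\sigma_q\}$, let $S(T)$ be the right key of $T\in\mathcal T_\lambda$, computed by the scanning method (described below), and let $d_\lambda(\sigma;x)=\sum x^{\Theta(T)}$ over the $T\in\mathcal T_\lambda$ with $S(T)\le Y_\lambda(\sigma)$ (the Demazure polynomial). *Scanning.* In the sequence of the bottom values of the columns of $T$, from left to right, form the earliest weakly increasing subsequence (start with the first term and always take the next term that is at least the last one taken), write its final value in the lowest free box of the first column of $S(T)$, remove the boxes of $T$ that contributed to the subsequence, and repeat until the first column of $T$ is used up. Column $j$ of $S(T)$ is found in the same way after deleting columns $1,\dots,j-1$ of the original $T$. **Theorem.** The following two statements are equivalent. (A) (Theorem of Postnikov and Stanley) For every 312-avoiding permutation $\sigma$ of $[n]$, the tuple $\Psi(\sigma)$ is an upper flag and $d_\lambda(\sigma;x)=s_\lambda(\Psi(\sigma);x)$. (B) For every $\lambda$-312-avoiding $\lambda$-permutation $\pi$, the tuple $\Psi_\lambda(\pi)$ is a gapless $\lambda$-tuple and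 $d_\lambda(\pi;x)=s_\lambda(\Psi_\lambda(\pi);x)$. More precisely, the equations in (A) and (B) are the same equations: the $\lambda$-projection $\sigma\mapsto\bar\sigma$ maps the 312-avoiding permutations onto the $\lambda$-312-avoiding $\lambda$-permutations, and for every 312-avoiding $\sigma$ one has $d_\lambda(\sigma;x)=d_\lambda(\bar\sigma;x)$ and $s_\lambda(\Psi(\sigma);x)=s_\lambda(\Psi_\lambda(\bar\sigma);x)$. -/

import Mathlib

/-!
Conventions. The set `[n] = {1, …, n}` is modelled by `Fin n`: the element `k` of `[n]` is the term
of `Fin n` with value `k - 1`, for indices and for entries alike. Comparisons and differences of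
elements of `[n]` are not affected by this shift. The columns of a shape are also numbered from `0`.
Cardinalities, column lengths and dividers `q ∈ R ⊆ {1, …, n - 1}` are not shifted, so the index
`i : Fin n` belongs to the first `q` indices exactly when `(i : ℕ) < q`.
-/

namespace FlagDemazure

/-! ### Tuples with entries in `[n]` -/

/-- The tuple is upper: `υ_i ≥ i` for every index `i`. -/
def IsUpper {n : ℕ} (υ : Fin n → Fin n) : Prop := ∀ i, i ≤ υ i

/-- Upper flags: weakly increasing upper tuples. -/
def IsUpperFlag {n : ℕ} (φ : Fin n → Fin n) : Prop := Monotone φ ∧ IsUpper φ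

/-- Permutations in one-line notation: tuples with distinct entries. -/
def IsPerm {n : ℕ} (π : Fin n → Fin n) : Prop := Function.Injective π

/-- `312`-avoiding permutations. -/
def IsPerm312 {n : ℕ} (π : Fin n → Fin n) : Prop :=
  IsPerm π ∧ ¬ ∃ a b c : Fin n, a < b ∧ b < c ∧ π b < π a ∧ π b < π c ∧ π c < π a

/-- `rank^d(Q)`, the `d`-th largest element of `Q`, for `1 ≤ d ≤ |Q|`
(the value is `junk` if `d > |Q|`). -/
def rankTop {n : ℕ} (Q : Finset (Fin n)) (d : ℕ) (junk : Fin n) : Fin n :=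
  (Q.sort (· ≥ ·)).getD (d - 1) junk

/-! ### Carrels, `R`-tuples -/

/-- Two indices lie in the same carrel: no divider `q ∈ R` separates them. -/
def SameCarrel {n : ℕ} (R : Finset ℕ) (i j : Fin n) : Prop :=
  ∀ q ∈ R, ((i : ℕ) < q ↔ (j : ℕ) < q)

instance {n : ℕ} (R : Finset ℕ) (i j : Fin n) : Decidable (SameCarrel R i j) := by
  unfold SameCarrel; infer_instance

/-- The right end `q_h` of the carrel `(q_{h-1}, q_h]` that contains the index `i`. -/
def carrelEnd {n : ℕ} (R : Finset ℕ) (i : Fin n) : ℕ :=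
  ((insert n R).filter (fun q => (i : ℕ) < q)).min'
    ⟨n, Finset.mem_filter.mpr ⟨Finset.mem_insert_self n R, i.isLt⟩⟩

/-- The tuple is (strictly) increasing on each carrel. -/
def IsRIncreasing {n : ℕ} (R : Finset ℕ) (α : Fin n → Fin n) : Prop :=
  ∀ i j, i < j → SameCarrel R i j → α i < α j

/-- `R`-permutations. -/
def IsRPerm {n : ℕ} (R : Finset ℕ) (π : Fin n → Fin n) : Prop :=
  IsPerm π ∧ IsRIncreasing R π

/-- `R`-`312`-containing tuples: for two consecutive dividers `q < q'` in `R` there are indices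
`a ≤ q < b ≤ q' < c` (numbered from `1`) such that `π_a > π_b < π_c` and `π_a > π_c`. -/
def IsR312Containing {n : ℕ} (R : Finset ℕ) (π : Fin n → Fin n) : Prop :=
  ∃ q ∈ R, ∃ q' ∈ R, q < q' ∧ (∀ p ∈ R, ¬ (q < p ∧ p < q')) ∧
    ∃ a b c : Fin n, (a : ℕ) < q ∧ q ≤ (b : ℕ) ∧ (b : ℕ) < q' ∧ q' ≤ (c : ℕ) ∧
      π b < π a ∧ π b < π c ∧ π c < π a

/-- `R`-`312`-avoiding `R`-permutations. -/
def IsRPerm312 {n : ℕ} (R : Finset ℕ) (π : Fin n → Fin n) : Prop :=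
  IsRPerm R π ∧ ¬ IsR312Containing R π

/-- The set of entries of `σ` on the carrel that contains the index `i`. -/
def cohort {n : ℕ} (R : Finset ℕ) (σ : Fin n → Fin n) (i : Fin n) : Finset (Fin n) :=
  (Finset.univ.filter (fun k => SameCarrel R i k)).image σ

/-- The `R`-projection `σ̄` of a permutation `σ`: the entries of each cohort are sorted into
increasing order within their carrel. -/
def rProj {n : ℕ} (R : Finset ℕ) (σ : Fin n → Fin n) : Fin n → Fin n :=
  fun i => rankTop (cohort R σ i) (carrelEnd R i - i) i

/-- The set `{π_1, …, π_q}` of the first `q` entries; the sets `B_h` of the chain of `π` are the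
values at the dividers `q = q_h`. -/
def firstEntries {n : ℕ} (π : Fin n → Fin n) (q : ℕ) : Finset (Fin n) :=
  (Finset.univ.filter (fun k : Fin n => (k : ℕ) < q)).image π

/-- The rank `R`-tuple `Ψ_R(π)`: on the carrel `(q_{h-1}, q_h]` its entries are the `p_h` largest
elements of `B_h` in increasing order, `ψ_i = rank^{q_h - i + 1}(B_h)` for `i` numbered from `1`. -/
def rankTuple {n : ℕ} (R : Finset ℕ) (π : Fin n → Fin n) : Fin n → Fin n :=
  fun i => rankTop (firstEntries π (carrelEnd R i)) (carrelEnd R i - i) i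

/-- The rank tuple `Ψ(σ)` of a permutation: the full case `R = {1, …, n - 1}`. -/
def fullRankTuple {n : ℕ} (σ : Fin n → Fin n) : Fin n → Fin n :=
  rankTuple (Finset.Icc 1 (n - 1)) σ

/-! ### Critical lists and gapless `R`-tuples -/

/-- The condition `υ_x - υ_y > x - y`, used for indices `y < x` in one carrel. -/
def Jump {n : ℕ} (υ : Fin n → Fin n) (y x : Fin n) : Prop :=
  ((υ x : ℕ) : ℤ) - ((υ y : ℕ) : ℤ) > ((x : ℕ) : ℤ) - ((y : ℕ) : ℤ)

/-- Critical indices of `υ`: the last index of each carrel is critical, and if `x` is critical, then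
so is the largest `y < x` in the same carrel with `υ_x - υ_y > x - y`, if there is such a `y`. -/
inductive IsCritical {n : ℕ} (R : Finset ℕ) (υ : Fin n → Fin n) : Fin n → Prop
  | last (x : Fin n) : (x : ℕ) + 1 = carrelEnd R x → IsCritical R υ x
  | next (x y : Fin n) : IsCritical R υ x → y < x → SameCarrel R y x → Jump υ y x →
      (∀ z, y < z → z < x → ¬ Jump υ z x) → IsCritical R υ y

/-- The `R`-critical list of `υ` is a flag `R`-critical list: the entry of `υ` at the last index `x`
of a carrel does not exceed the entry at the leftmost critical index `k` of the next carrel. -/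
def HasFlagCriticalList {n : ℕ} (R : Finset ℕ) (υ : Fin n → Fin n) : Prop :=
  ∀ x k : Fin n, (x : ℕ) + 1 ∈ R → x < k → (∀ p ∈ R, ¬ ((x : ℕ) + 1 < p ∧ p ≤ (k : ℕ))) →
    IsCritical R υ k → (∀ k', IsCritical R υ k' → SameCarrel R k k' → k ≤ k') → υ x ≤ υ k

/-- Gapless core `R`-tuples. -/
def IsGaplessCore {n : ℕ} (R : Finset ℕ) (η : Fin n → Fin n) : Prop :=
  IsUpper η ∧ HasFlagCriticalList R η

/-- Gapless `R`-tuples: the gapless core `R`-tuples that are `R`-increasing. -/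
def IsGapless {n : ℕ} (R : Finset ℕ) (γ : Fin n → Fin n) : Prop :=
  IsGaplessCore R γ ∧ IsRIncreasing R γ

/-! ### Shapes and tableaux

A partition is a weakly decreasing `lam : Fin n → ℕ`, its row lengths. -/

/-- The length of the column `j` of the shape. -/
def colLen {n : ℕ} (lam : Fin n → ℕ) (j : ℕ) : ℕ :=
  (Finset.univ.filter (fun i => j < lam i)).card

/-- The number of columns of the shape (the largest part). -/
def numCols {n : ℕ} (lam : Fin n → ℕ) : ℕ := Finset.univ.sup lam

/-- `R_λ`: the set of the column lengths of `λ` that are less than `n`. -/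
def dividers {n : ℕ} (lam : Fin n → ℕ) : Finset ℕ :=
  ((Finset.range (numCols lam)).image (colLen lam)).filter (fun q => q < n)

/-- Fillings of the shape with values from `[n]`, as functions of the row and of the box in the row.
They are compared entrywise. -/
abbrev Filling {n : ℕ} (lam : Fin n → ℕ) : Type := (i : Fin n) → Fin (lam i) → Fin n

/-- Semistandard tableaux: weakly increasing along rows, strictly increasing down columns. -/
def IsTableau {n : ℕ} {lam : Fin n → ℕ} (T : Filling lam) : Prop :=
  (∀ (i : Fin n) (j j' : Fin (lam i)), j ≤ j' → T i j ≤ T i j') ∧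
  (∀ (i i' : Fin n) (j : Fin (lam i)) (j' : Fin (lam i')), i < i' → (j : ℕ) = (j' : ℕ) →
    T i j < T i' j')

instance {n : ℕ} {lam : Fin n → ℕ} (T : Filling lam) : Decidable (IsTableau T) := by
  unfold IsTableau; infer_instance

/-- The content of `T`: the number of values equal to `k`. -/
def content {n : ℕ} {lam : Fin n → ℕ} (T : Filling lam) (k : Fin n) : ℕ :=
  (Finset.univ.filter (fun b : (Σ i : Fin n, Fin (lam i)) => T b.1 b.2 = k)).card

/-- The weight `x^{Θ(T)}`. -/
noncomputable def weight {n : ℕ} {lam : Fin n → ℕ} (T : Filling lam) : MvPolynomial (Fin n) ℤ :=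
  ∏ k, MvPolynomial.X k ^ content T k

/-! ### Row bound sets -/

/-- `𝒮_λ(β)`: the tableaux whose values in the row `i` are at most `β_i`. The bounds also apply to the
latent column of length `n` with the values `1, …, n` that is prepended to `T`. -/
def rowBoundSet {n : ℕ} (lam : Fin n → ℕ) (β : Fin n → Fin n) : Finset (Filling lam) :=
  Finset.univ.filter (fun T => IsTableau T ∧ (∀ i, i ≤ β i) ∧ ∀ i j, T i j ≤ β i)

/-- The row bound sum `s_λ(β; x)`; it is a flag Schur polynomial if `β` is an upper flag. -/
noncomputable def rowBoundSum {n : ℕ} (lam : Fin n → ℕ) (β : Fin n → Fin n) :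
    MvPolynomial (Fin n) ℤ :=
  ∑ T ∈ rowBoundSet lam β, weight T

/-! ### Keys, scanning tableaux and Demazure polynomials -/

/-- The `λ`-key `Y_λ(σ)` of a permutation: a column of length `q` consists of the elements of
`{σ_1, …, σ_q}`, increasing from top to bottom. -/
def key {n : ℕ} (lam : Fin n → ℕ) (σ : Fin n → Fin n) : Filling lam :=
  fun i j => rankTop (firstEntries σ (colLen lam j)) (colLen lam j - i) i

/-- Columns are listed from bottom to top, from left to right. The scan continues an earliest weakly
increasing subsequence of the bottom values, whose last value so far is `v`, through the given
columns: it returns the final value of the subsequence and what is left of the columns after the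
boxes that contributed to the subsequence have been removed. -/
def scan {n : ℕ} (v : Fin n) : List (List (Fin n)) → Fin n × List (List (Fin n))
  | [] => (v, [])
  | [] :: cs => ((scan v cs).1, [] :: (scan v cs).2)
  | (x :: c) :: cs =>
      if v ≤ x then ((scan x cs).1, c :: (scan x cs).2)
      else ((scan v cs).1, (x :: c) :: (scan v cs).2)

/-- The values, from bottom to top, of the first column of the scanning tableau of the tableau with
first column `c` and further columns `cs`: the final values of the successive scans that start at the
lowest box that is left in the first column. -/
def scanColumn {n : ℕ} : List (Fin n) → List (List (Fin n)) → List (Fin n)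
  | [], _ => []
  | x :: c, cs => (scan x cs).1 :: scanColumn c (scan x cs).2

/-- The values in the column `j` of `T`, from bottom to top. -/
def column {n : ℕ} {lam : Fin n → ℕ} (T : Filling lam) (j : ℕ) : List (Fin n) :=
  (List.finRange n).reverse.filterMap
    (fun i => if h : j < lam i then some (T i ⟨j, h⟩) else none)

/-- The scanning tableau `S(T)`, which is the right key of `T`: to find its column `j`, the columns of
`T` to the left of the column `j` are ignored. -/
def scanning {n : ℕ} {lam : Fin n → ℕ} (T : Filling lam) : Filling lam :=
  fun i j =>
    (scanColumn (column T j)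
      ((List.range' ((j : ℕ) + 1) (numCols lam - (j + 1))).map (column T))).getD
      (colLen lam j - 1 - i) (T i j)

/-- `𝒟_λ(σ)`: the Demazure tableaux, those `T` with `S(T) ≤ Y_λ(σ)`. -/
def demazureSet {n : ℕ} (lam : Fin n → ℕ) (σ : Fin n → Fin n) : Finset (Filling lam) :=
  Finset.univ.filter (fun T => IsTableau T ∧ ∀ i j, scanning T i j ≤ key lam σ i j)

/-- The Demazure polynomial `d_λ(σ; x)`. -/
noncomputable def demazurePoly {n : ℕ} (lam : Fin n → ℕ) (σ : Fin n → Fin n) :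
    MvPolynomial (Fin n) ℤ :=
  ∑ T ∈ demazureSet lam σ, weight T

/-! ### The two results that are compared -/

/-- For every `312`-avoiding permutation `σ`, the tuple `Ψ(σ)` is an upper flag and
`d_λ(σ; x) = s_λ(Ψ(σ); x)`. -/
def PostnikovStanley {n : ℕ} (lam : Fin n → ℕ) : Prop :=
  ∀ σ : Fin n → Fin n, IsPerm312 σ →
    IsUpperFlag (fullRankTuple σ) ∧ demazurePoly lam σ = rowBoundSum lam (fullRankTuple σ)

/-- For every `λ`-`312`-avoiding `λ`-permutation `π`, the tuple `Ψ_λ(π)` is a gapless `λ`-tuple and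
`d_λ(π; x) = s_λ(Ψ_λ(π); x)`. -/
def ParabolicCoincidence {n : ℕ} (lam : Fin n → ℕ) : Prop :=
  ∀ π : Fin n → Fin n, IsRPerm312 (dividers lam) π →
    IsGapless (dividers lam) (rankTuple (dividers lam) π) ∧
      demazurePoly lam π = rowBoundSum lam (rankTuple (dividers lam) π)

end FlagDemazure

namespace FlagDemazure

variable {n : ℕ}

/-! ### Ranks in finite sets -/

/-! All columns have lengths in `insert n (dividers lam)`, so both the key of `σ` and its rank
`λ`-tuple see only the sets of first `q` entries for such `q`. Rearranging `σ` within carrels leaves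
these sets alone, and the projection is such a rearrangement (`exists_rProj_eq_comp`). This settles
the Demazure side.

On the row bound side the two sets of tableaux are equal (`rowBoundSet_fullRankTuple`). The rank
`λ`-tuple lies entrywise below the full one, which gives one inclusion. For the other, the rows of a
carrel have equal length and columns increase strictly, so a bound `β` on row `k` bounds row `i ≤ k`
of the same carrel by `β - (k - i)`. Avoidance of `312` supplies a `k` for which this is at most the
entry `i` of the rank `λ`-tuple (`exists_fullRankTuple_le`).

Projections avoid the `R`-pattern (`isRPerm312_rProj`), and every avoiding `R`-permutation is a
projection (`exists_isPerm312_rProj_eq`), so the two families of equations coincide. The upper flag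
and gapless claims are proved outright; the latter (`isGapless_rankTuple`) shares the counting
argument `exists_pattern` with the row bounds. -/

lemma rankTop_spec {Q : Finset (Fin n)} {d : ℕ} (hd : d < Q.card) (junk : Fin n) :
    rankTop Q (d + 1) junk ∈ Q ∧ (Q.filter (fun u => rankTop Q (d + 1) junk < u)).card = d := by
  have hlen : d < (Q.sort (· ≥ ·)).length := by simpa using hd
  have hval : rankTop Q (d + 1) junk = (Q.sort (· ≥ ·))[d] := by
    simp only [rankTop, Nat.add_sub_cancel]
    exact List.getD_eq_getElem _ _ hlen
  have hanti : StrictAnti (Q.sort (· ≥ ·)).get := (Finset.sortedGT_sort Q).strictAnti_get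
  refine ⟨?_, ?_⟩
  · rw [hval]
    exact (Finset.mem_sort (· ≥ ·)).1 (List.getElem_mem hlen)
  · have himg : Q.filter (fun u => rankTop Q (d + 1) junk < u) =
        (Finset.Iio (⟨d, hlen⟩ : Fin (Q.sort (· ≥ ·)).length)).image (Q.sort (· ≥ ·)).get := by
      ext u
      simp only [Finset.mem_filter, Finset.mem_image, Finset.mem_Iio, hval]
      constructor
      · rintro ⟨hu, hlt⟩
        obtain ⟨k, rfl⟩ := List.mem_iff_get.1 ((Finset.mem_sort (· ≥ ·)).2 hu)
        exact ⟨k, hanti.lt_iff_gt.1 hlt, rfl⟩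
      · rintro ⟨k, hk, rfl⟩
        exact ⟨(Finset.mem_sort (· ≥ ·)).1 (List.get_mem _ _), hanti hk⟩
    rw [himg, Finset.card_image_of_injective _ hanti.injective, Fin.card_Iio]

lemma eq_of_card_filter_gt_eq {Q : Finset (Fin n)} {u v : Fin n} (hu : u ∈ Q) (hv : v ∈ Q)
    (h : (Q.filter (fun w => u < w)).card = (Q.filter (fun w => v < w)).card) : u = v := by
  have key : ∀ {a b : Fin n}, b ∈ Q → a < b →
      (Q.filter (fun w => b < w)).card < (Q.filter (fun w => a < w)).card := by
    intro a b hb hab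
    refine Finset.card_lt_card ⟨fun w hw => ?_, fun hs => ?_⟩
    · simp only [Finset.mem_filter] at hw ⊢
      exact ⟨hw.1, hab.trans hw.2⟩
    · have := hs (Finset.mem_filter.2 ⟨hb, hab⟩)
      simp at this
  rcases lt_trichotomy u v with huv | huv | huv
  · exact absurd h (key hv huv).ne'
  · exact huv
  · exact absurd h (key hu huv).ne

lemma rankTop_eq {Q : Finset (Fin n)} {d : ℕ} {v junk : Fin n} (hv : v ∈ Q)
    (hd : (Q.filter (fun u => v < u)).card + 1 = d) : rankTop Q d junk = v := by
  subst hd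
  have hlt : (Q.filter (fun u => v < u)).card < Q.card :=
    Finset.card_lt_card (Finset.filter_ssubset.2 ⟨v, hv, lt_irrefl v⟩)
  obtain ⟨hmem, hcard⟩ := rankTop_spec hlt junk
  exact eq_of_card_filter_gt_eq hmem hv hcard

/-! ### Carrels -/

section Carrels

variable (R : Finset ℕ)

lemma carrelEnd_mem (i : Fin n) : carrelEnd R i ∈ insert n R ∧ (i : ℕ) < carrelEnd R i :=
  Finset.mem_filter.1 (Finset.min'_mem _ _)

lemma carrelEnd_le_of_mem {i : Fin n} {q : ℕ} (hq : q ∈ insert n R) (hi : (i : ℕ) < q) :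
    carrelEnd R i ≤ q :=
  Finset.min'_le _ _ (Finset.mem_filter.2 ⟨hq, hi⟩)

lemma carrelEnd_le (i : Fin n) : carrelEnd R i ≤ n :=
  carrelEnd_le_of_mem R (Finset.mem_insert_self n R) i.isLt

lemma carrelEnd_mono : Monotone (carrelEnd R : Fin n → ℕ) := fun _ j hij =>
  carrelEnd_le_of_mem R (carrelEnd_mem R j).1
    (lt_of_le_of_lt (Fin.le_def.1 hij) (carrelEnd_mem R j).2)

variable {R}

lemma carrelEnd_eq_of_lt {i j : Fin n} (hij : i ≤ j) (hj : (j : ℕ) < carrelEnd R i) :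
    carrelEnd R i = carrelEnd R j :=
  le_antisymm (carrelEnd_mono R hij) (carrelEnd_le_of_mem R (carrelEnd_mem R i).1 hj)

lemma lt_iff_lt_of_carrelEnd_eq {i j : Fin n} (h : carrelEnd R i = carrelEnd R j) {q : ℕ}
    (hq : q ∈ insert n R) : (i : ℕ) < q ↔ (j : ℕ) < q :=
  ⟨fun hi => (carrelEnd_mem R j).2.trans_le (h ▸ carrelEnd_le_of_mem R hq hi),
    fun hj => (carrelEnd_mem R i).2.trans_le (h ▸ carrelEnd_le_of_mem R hq hj)⟩

/-- The right end serves as a monotone, numerical label of the carrel, so later arguments compare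
labels instead of quantifying over dividers. -/
lemma sameCarrel_iff {i j : Fin n} : SameCarrel R i j ↔ carrelEnd R i = carrelEnd R j := by
  refine ⟨fun h => ?_, fun h q hq => lt_iff_lt_of_carrelEnd_eq h (Finset.mem_insert_of_mem hq)⟩
  have h' : ∀ q ∈ insert n R, ((i : ℕ) < q ↔ (j : ℕ) < q) := by
    intro q hq
    rcases Finset.mem_insert.1 hq with rfl | hq
    · simp
    · exact h q hq
  unfold carrelEnd
  congr 1
  exact Finset.filter_congr h'

lemma carrelEnd_Icc (i : Fin n) : carrelEnd (Finset.Icc 1 (n - 1)) i = (i : ℕ) + 1 := by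
  have h1 := (carrelEnd_mem (Finset.Icc 1 (n - 1)) i).2
  refine le_antisymm (carrelEnd_le_of_mem _ ?_ (Nat.lt_succ_self _)) h1
  have := i.isLt
  rw [Finset.mem_insert, Finset.mem_Icc]
  omega

end Carrels

/-! ### Rearrangements within the carrels -/

section Rearrange

variable {R : Finset ℕ} {τ : Equiv.Perm (Fin n)}

/-- No index crosses a divider under `τ`, so `τ` permutes the first `q` indices among themselves.
Keys and rank tuples inherit their invariance from this. -/
lemma firstEntries_comp (hτ : ∀ k, carrelEnd R (τ k) = carrelEnd R k) (σ : Fin n → Fin n) {q : ℕ}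
    (hq : q ∈ insert n R) : firstEntries (σ ∘ τ) q = firstEntries σ q := by
  ext v
  simp only [firstEntries, Finset.mem_image, Finset.mem_filter, Finset.mem_univ, true_and,
    Function.comp]
  constructor
  · rintro ⟨k, hk, rfl⟩
    exact ⟨τ k, (lt_iff_lt_of_carrelEnd_eq (hτ k) hq).2 hk, rfl⟩
  · rintro ⟨k, hk, rfl⟩
    refine ⟨τ.symm k, (lt_iff_lt_of_carrelEnd_eq (hτ (τ.symm k)) hq).1 ?_, ?_⟩ <;> simp [hk]

lemma cohort_comp (hτ : ∀ k, carrelEnd R (τ k) = carrelEnd R k) (σ : Fin n → Fin n) (i : Fin n) :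
    cohort R (σ ∘ τ) i = cohort R σ i := by
  ext v
  simp only [cohort, Finset.mem_image, Finset.mem_filter, Finset.mem_univ, true_and,
    Function.comp, sameCarrel_iff]
  constructor
  · rintro ⟨k, hk, rfl⟩
    exact ⟨τ k, hk.trans (hτ k).symm, rfl⟩
  · rintro ⟨k, hk, rfl⟩
    refine ⟨τ.symm k, ?_, by simp⟩
    rw [hk, ← hτ (τ.symm k), Equiv.apply_symm_apply]

lemma rProj_comp (hτ : ∀ k, carrelEnd R (τ k) = carrelEnd R k) (σ : Fin n → Fin n) :
    rProj R (σ ∘ τ) = rProj R σ := by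
  funext i
  simp only [rProj, cohort_comp hτ]

lemma rankTuple_comp (hτ : ∀ k, carrelEnd R (τ k) = carrelEnd R k) (σ : Fin n → Fin n) :
    rankTuple R (σ ∘ τ) = rankTuple R σ := by
  funext i
  simp only [rankTuple, firstEntries_comp hτ σ (carrelEnd_mem R i).1]

/-- In an `R`-increasing tuple the entries of the cohort that exceed `π i` are exactly those to the
right of `i` in its carrel, so `π i` already has the required rank. -/
lemma rProj_eq_self {π : Fin n → Fin n} (hπ : IsRPerm R π) : rProj R π = π := by
  funext i
  have hi := (carrelEnd_mem R i).2
  refine rankTop_eq (Finset.mem_image_of_mem _ (by simp [sameCarrel_iff])) ?_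
  have hset : (cohort R π i).filter (fun u => π i < u) =
      (Finset.univ.filter (fun k : Fin n => i < k ∧ (k : ℕ) < carrelEnd R i)).image π := by
    ext v
    simp only [cohort, Finset.mem_image, Finset.mem_filter, Finset.mem_univ, true_and]
    constructor
    · rintro ⟨⟨k, hk, rfl⟩, hlt⟩
      refine ⟨k, ⟨?_, ?_⟩, rfl⟩
      · rcases lt_trichotomy i k with h | h | h
        · exact h
        · exact absurd hlt (by simp [h])
        · refine absurd (hπ.2 k i h ?_) hlt.asymm
          rw [sameCarrel_iff] at hk ⊢
          exact hk.symm
      · rw [sameCarrel_iff.1 hk]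
        exact (carrelEnd_mem R k).2
    · rintro ⟨k, ⟨hik, hk⟩, rfl⟩
      have hs : SameCarrel R i k := sameCarrel_iff.2 (carrelEnd_eq_of_lt hik.le hk)
      exact ⟨⟨k, hs, rfl⟩, hπ.2 i k hik hs⟩
  have hcard : (Finset.univ.filter (fun k : Fin n => i < k ∧ (k : ℕ) < carrelEnd R i)).card =
      carrelEnd R i - (i + 1) := by
    rw [← Nat.card_Ico, ← Finset.card_map Fin.valEmbedding]
    congr 1
    ext m
    simp only [Finset.mem_map, Finset.mem_filter, Finset.mem_univ, true_and,
      Fin.valEmbedding_apply, Finset.mem_Ico]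
    constructor
    · rintro ⟨k, ⟨h1, h2⟩, rfl⟩
      exact ⟨h1, h2⟩
    · rintro ⟨h1, h2⟩
      exact ⟨⟨m, h2.trans_le (carrelEnd_le R i)⟩, ⟨h1, h2⟩, rfl⟩
  rw [hset, Finset.card_image_of_injective _ hπ.1, hcard]
  omega

/-- The entries of each carrel can be put in the order given by a ranking function. -/
lemma exists_carrel_sort (R : Finset ℕ) (f : Fin n → ℤ) : ∃ τ : Equiv.Perm (Fin n),
    (∀ k, carrelEnd R (τ k) = carrelEnd R k) ∧
      ∀ i j, i ≤ j → carrelEnd R i = carrelEnd R j → f (τ i) ≤ f (τ j) := by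
  -- Lexicographic order with the carrel label first: sorting all indices at once then sorts each
  -- carrel separately.
  let g : Fin n → ℕ ×ₗ ℤ := fun k => toLex (carrelEnd R k, f k)
  have hg : Monotone (g ∘ Tuple.sort g) := Tuple.monotone_sort g
  -- The labels after sorting form a monotone rearrangement of a sequence that was monotone already,
  -- hence the same sequence.
  have hE : ∀ k, carrelEnd R (Tuple.sort g k) = carrelEnd R k := by
    have h1 : Monotone (carrelEnd R ∘ Tuple.sort g) := fun i j hij => by
      rcases Prod.Lex.le_iff.1 (hg hij) with h | h
      · exact h.le
      · exact h.1.le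
    have h2 : Monotone (carrelEnd R ∘ (1 : Equiv.Perm (Fin n))) := carrelEnd_mono R
    exact congrFun ((Tuple.comp_sort_eq_comp_iff_monotone.2 h1).trans
      (Tuple.comp_sort_eq_comp_iff_monotone.2 h2).symm)
  refine ⟨Tuple.sort g, hE, fun i j hij h => ?_⟩
  rcases Prod.Lex.le_iff.1 (hg hij) with h' | h'
  · refine absurd h' (not_lt_of_ge ?_)
    change carrelEnd R (Tuple.sort g j) ≤ carrelEnd R (Tuple.sort g i)
    rw [hE, hE, h]
  · exact h'.2

lemma exists_rProj_eq_comp (R : Finset ℕ) {σ : Fin n → Fin n} (hσ : IsPerm σ) :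
    ∃ τ : Equiv.Perm (Fin n), (∀ k, carrelEnd R (τ k) = carrelEnd R k) ∧
      rProj R σ = σ ∘ τ ∧ IsRPerm R (σ ∘ τ) := by
  obtain ⟨τ, hτ, hmono⟩ := exists_carrel_sort R (fun k => ((σ k : ℕ) : ℤ))
  have hinj : IsPerm (σ ∘ τ) := hσ.comp τ.injective
  have hperm : IsRPerm R (σ ∘ τ) := by
    refine ⟨hinj, fun i j hij hs => lt_of_le_of_ne ?_ (hinj.ne hij.ne)⟩
    have := hmono i j hij.le (sameCarrel_iff.1 hs)
    exact Fin.le_def.2 (by exact_mod_cast this)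
  exact ⟨τ, hτ, by rw [← rProj_comp hτ, rProj_eq_self hperm], hperm⟩

/-- The dividers that separate the positions of an `R`-pattern in `σ ∘ τ` also separate their images
under `τ`, so these images keep their order and exhibit a `312` in `σ`. -/
lemma isRPerm312_rProj (R : Finset ℕ) {σ : Fin n → Fin n} (hσ : IsPerm312 σ) :
    IsRPerm312 R (rProj R σ) := by
  obtain ⟨τ, hτ, heq, hperm⟩ := exists_rProj_eq_comp R hσ.1
  rw [heq]
  refine ⟨hperm, ?_⟩
  rintro ⟨q, hq, q', hq', -, -, a, b, c, ha, hb, hb', hc, h1, h2, h3⟩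
  have key : ∀ {k : Fin n} {p : ℕ}, p ∈ R → ((τ k : ℕ) < p ↔ (k : ℕ) < p) := fun hp =>
    lt_iff_lt_of_carrelEnd_eq (hτ _) (Finset.mem_insert_of_mem hp)
  have ha' := (key hq).2 ha
  have hb1 := (key (k := b) hq).not.2 hb.not_gt
  have hb2 := (key hq').2 hb'
  have hc' := (key (k := c) hq').not.2 hc.not_gt
  exact hσ.2 ⟨τ a, τ b, τ c, Fin.lt_def.2 (by omega), Fin.lt_def.2 (by omega), h1, h2, h3⟩

/-- Within each carrel, list the entries that are exceeded by an entry of an earlier carrel in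
decreasing order, and then the other entries in increasing order. -/
lemma exists_isPerm312_rProj_eq {π : Fin n → Fin n} (hπ : IsRPerm312 R π) :
    ∃ σ : Fin n → Fin n, IsPerm312 σ ∧ rProj R σ = π := by
  classical
  let low : Fin n → Prop := fun k => ∃ a, carrelEnd R a < carrelEnd R k ∧ π k < π a
  -- The shift by `-1` makes the key of every low entry negative, so low entries precede the others
  -- without ties.
  obtain ⟨τ, hτ, hmono⟩ := exists_carrel_sort R
    (fun k => if low k then -((π k : ℕ) : ℤ) - 1 else ((π k : ℕ) : ℤ))
  refine ⟨π ∘ τ, ⟨hπ.1.1.comp τ.injective, ?_⟩, by rw [rProj_comp hτ, rProj_eq_self hπ.1]⟩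
  rintro ⟨a, b, c, hab, hbc, h1, h2, h3⟩
  simp only [Function.comp, Fin.lt_def] at h1 h2 h3
  -- In the same carrel a descent from `a` to `b` cannot occur between two entries that are not low,
  -- and whatever exceeds a low entry at `a` also exceeds the one at `b`.
  have hlowb : low (τ b) := by
    by_contra hb
    rcases (carrelEnd_mono R hab.le).lt_or_eq with h | h
    · exact hb ⟨τ a, by rwa [hτ, hτ], h1⟩
    · have := hmono a b hab.le h
      simp only [if_neg hb] at this
      by_cases ha : low (τ a)
      · obtain ⟨a', ha1, ha2⟩ := ha
        rw [hτ, h] at ha1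
        exact hb ⟨a', by rwa [hτ], lt_trans h1 ha2⟩
      · rw [if_neg ha] at this
        omega
  -- The large entry of the pattern can be moved to a carrel before that of `b`: if `a` shares the
  -- carrel of `b`, it precedes a low entry, so it is low itself, and the entry exceeding it takes
  -- its place.
  obtain ⟨a', ha1, ha2⟩ : ∃ a', carrelEnd R a' < carrelEnd R b ∧ π (τ c) < π a' := by
    rcases (carrelEnd_mono R hab.le).lt_or_eq with h | h
    · exact ⟨τ a, by rwa [hτ], h3⟩
    · have := hmono a b hab.le h
      by_cases ha : low (τ a)
      · obtain ⟨a', ha1, ha2⟩ := ha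
        exact ⟨a', by rwa [hτ, h] at ha1, lt_trans h3 ha2⟩
      · simp only [if_pos hlowb, if_neg ha] at this
        omega
  -- In the carrel of `b` the entry at `c` would be low too, but low entries decrease.
  have hbc' : carrelEnd R b < carrelEnd R c := by
    refine (carrelEnd_mono R hbc.le).lt_of_ne fun h => ?_
    have hc : low (τ c) := ⟨a', by rwa [hτ, ← h], ha2⟩
    have := hmono b c hbc.le h
    simp only [if_pos hlowb, if_pos hc] at this
    omega
  have hRmem : ∀ k : Fin n, carrelEnd R k < n → carrelEnd R k ∈ R := fun k hk =>
    (Finset.mem_insert.1 (carrelEnd_mem R k).1).resolve_left hk.ne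
  have hb := carrelEnd_mem R b
  -- the divider that precedes the carrel of `b`
  have hne : (R.filter (fun p => p ≤ (b : ℕ))).Nonempty := by
    refine ⟨carrelEnd R a', Finset.mem_filter.2
      ⟨hRmem _ (ha1.trans_le (carrelEnd_le R b)), not_lt.1 fun h => ?_⟩⟩
    exact absurd (carrelEnd_le_of_mem R (carrelEnd_mem R a').1 h) ha1.not_ge
  obtain ⟨hqR, hqb⟩ := Finset.mem_filter.1 (Finset.max'_mem _ hne)
  set q := (R.filter (fun p => p ≤ (b : ℕ))).max' hne with hq
  have haq : carrelEnd R a' ≤ q := by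
    refine Finset.le_max' (R.filter (fun p => p ≤ (b : ℕ))) _ (Finset.mem_filter.2
      ⟨hRmem _ (ha1.trans_le (carrelEnd_le R b)), not_lt.1 fun h => ?_⟩)
    exact absurd (carrelEnd_le_of_mem R (carrelEnd_mem R a').1 h) ha1.not_ge
  refine hπ.2 ⟨q, hqR, carrelEnd R b, hRmem b (hbc'.trans_le (carrelEnd_le R c)),
    lt_of_le_of_lt hqb hb.2, ?_, a', τ b, τ c, (carrelEnd_mem R a').2.trans_le haq, ?_, ?_, ?_,
    lt_trans h2 ha2, h2, ha2⟩
  · rintro p hp ⟨h4, h5⟩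
    rcases le_or_gt p (b : ℕ) with h | h
    · exact absurd (Finset.le_max' _ _ (Finset.mem_filter.2 ⟨hp, h⟩)) h4.not_ge
    · exact absurd (carrelEnd_le_of_mem R (Finset.mem_insert_of_mem hp) h) h5.not_ge
  · exact not_lt.1 fun h => absurd ((lt_iff_lt_of_carrelEnd_eq (hτ b)
      (Finset.mem_insert_of_mem hqR)).1 h) hqb.not_gt
  · rw [← hτ b]
    exact (carrelEnd_mem R _).2
  · refine not_lt.1 fun h => ?_
    have := (lt_iff_lt_of_carrelEnd_eq (hτ c) hb.1).1 h
    exact absurd (carrelEnd_le_of_mem R hb.1 this) hbc'.not_ge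

end Rearrange

/-! ### Rank tuples -/

section RankTuple

lemma mem_firstEntries {σ : Fin n → Fin n} {q : ℕ} {v : Fin n} :
    v ∈ firstEntries σ q ↔ ∃ k : Fin n, (k : ℕ) < q ∧ σ k = v := by
  simp [firstEntries]

lemma firstEntries_subset (σ : Fin n → Fin n) {p q : ℕ} (h : p ≤ q) :
    firstEntries σ p ⊆ firstEntries σ q := fun v hv => by
  obtain ⟨k, hk, rfl⟩ := mem_firstEntries.1 hv
  exact mem_firstEntries.2 ⟨k, hk.trans_le h, rfl⟩

variable {σ : Fin n → Fin n} (hσ : IsPerm σ)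
include hσ

lemma card_firstEntries {q : ℕ} (hq : q ≤ n) : (firstEntries σ q).card = q := by
  rw [firstEntries, Finset.card_image_of_injective _ hσ, ← Finset.card_map Fin.valEmbedding]
  conv_rhs => rw [← Finset.card_range q]
  congr 1
  ext m
  simp only [Finset.mem_map, Finset.mem_filter, Finset.mem_univ, true_and,
    Fin.valEmbedding_apply, Finset.mem_range]
  exact ⟨fun ⟨k, hk, h⟩ => h ▸ hk, fun h => ⟨⟨m, h.trans_le hq⟩, h, rfl⟩⟩

/-- If the entry `w` comes after the first `e` entries, and `v > w` is among the first `q` entries,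
where `q` does not exceed the number of entries below `w` among the first `e`, then an entry below
`w` lies between the first `q` and the last `n - e` entries. -/
lemma exists_pattern {q e : ℕ} {v w : Fin n} (hqe : q ≤ e) (hen : e ≤ n)
    (hw : w ∉ firstEntries σ e) (hv : v ∈ firstEntries σ q) (hwv : w ≤ v)
    (hcard : q ≤ ((firstEntries σ e).filter (fun u => u < w)).card) :
    ∃ a b c : Fin n, (a : ℕ) < q ∧ q ≤ (b : ℕ) ∧ (b : ℕ) < e ∧ e ≤ (c : ℕ) ∧
      σ b < σ a ∧ σ b < σ c ∧ σ c < σ a := by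
  obtain ⟨a, ha, rfl⟩ := mem_firstEntries.1 hv
  obtain ⟨c, rfl⟩ := (Finite.injective_iff_surjective.1 hσ) w
  have hc : e ≤ (c : ℕ) := not_lt.1 fun h => hw (mem_firstEntries.2 ⟨c, h, rfl⟩)
  have hne : σ c ≠ σ a := fun h => hw (h ▸ firstEntries_subset σ hqe hv)
  have hlt := lt_of_le_of_ne hwv hne
  suffices ∃ b : Fin n, q ≤ (b : ℕ) ∧ (b : ℕ) < e ∧ σ b < σ c by
    obtain ⟨b, h1, h2, h3⟩ := this
    exact ⟨a, b, c, ha, h1, h2, hc, h3.trans hlt, h3, hlt⟩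
  by_contra! hno
  -- Pigeonhole: if all entries below `σ c` among the first `e` were among the first `q`, there
  -- would be at most `q - 1` of them, since `σ a` is not below `σ c`.
  have hsub : (firstEntries σ e).filter (fun u => u < σ c) ⊆ (firstEntries σ q).erase (σ a) := by
    intro u hu
    obtain ⟨hu, huc⟩ := Finset.mem_filter.1 hu
    obtain ⟨b, hb, rfl⟩ := mem_firstEntries.1 hu
    refine Finset.mem_erase.2 ⟨(huc.trans hlt).ne, mem_firstEntries.2 ⟨b, ?_, rfl⟩⟩
    exact not_le.1 fun h => absurd huc (hno b h hb).not_gt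
  have h1 := Finset.card_le_card hsub
  rw [Finset.card_erase_of_mem hv, card_firstEntries hσ (hqe.trans hen)] at h1
  omega

variable (R : Finset ℕ) (i : Fin n)

lemma rankTuple_mem : rankTuple R σ i ∈ firstEntries σ (carrelEnd R i) := by
  have hi := (carrelEnd_mem R i).2
  have hn := carrelEnd_le R i
  have h := (rankTop_spec (Q := firstEntries σ (carrelEnd R i)) (d := carrelEnd R i - i - 1)
    (by rw [card_firstEntries hσ hn]; omega) i).1
  rwa [show carrelEnd R i - i - 1 + 1 = carrelEnd R i - i by omega] at h

lemma card_rankTuple_lt :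
    ((firstEntries σ (carrelEnd R i)).filter (fun u => rankTuple R σ i < u)).card =
      carrelEnd R i - i - 1 := by
  have hi := (carrelEnd_mem R i).2
  have hn := carrelEnd_le R i
  have h := (rankTop_spec (Q := firstEntries σ (carrelEnd R i)) (d := carrelEnd R i - i - 1)
    (by rw [card_firstEntries hσ hn]; omega) i).2
  rwa [show carrelEnd R i - i - 1 + 1 = carrelEnd R i - i by omega] at h

/-- Counted from below, the rank is `i + 1` whatever the length of the carrel; this makes entries
for different carrels comparable. -/
lemma card_le_rankTuple :
    ((firstEntries σ (carrelEnd R i)).filter (fun u => u ≤ rankTuple R σ i)).card = i + 1 := by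
  have hi := (carrelEnd_mem R i).2
  have h1 := card_rankTuple_lt hσ R i
  have h2 := Finset.card_filter_add_card_filter_not (s := firstEntries σ (carrelEnd R i))
    (fun u => u ≤ rankTuple R σ i)
  rw [card_firstEntries hσ (carrelEnd_le R i)] at h2
  simp only [not_le] at h2
  omega

lemma isUpper_rankTuple : IsUpper (rankTuple R σ) := fun i => by
  have h := Finset.card_le_card (s := (firstEntries σ (carrelEnd R i)).filter
    (fun u => u ≤ rankTuple R σ i)) (t := Finset.Iic (rankTuple R σ i))
    (fun u hu => Finset.mem_Iic.2 (Finset.mem_filter.1 hu).2)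
  rw [card_le_rankTuple hσ, Fin.card_Iic] at h
  exact Fin.le_def.2 (by omega)

lemma isRIncreasing_rankTuple : IsRIncreasing R (rankTuple R σ) := fun i j hij hs => by
  by_contra! hle
  have h := Finset.card_le_card (s := (firstEntries σ (carrelEnd R j)).filter
    (fun u => u ≤ rankTuple R σ j)) (t := (firstEntries σ (carrelEnd R j)).filter
    (fun u => u ≤ rankTuple R σ i))
    (Finset.monotone_filter_right _ fun u _ (hu : u ≤ _) => hu.trans hle)
  rw [card_le_rankTuple hσ, ← sameCarrel_iff.1 hs, card_le_rankTuple hσ] at h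
  have := Fin.lt_def.1 hij
  omega

variable {R} {i}

lemma le_rankTuple_of_last (hi : carrelEnd R i = (i : ℕ) + 1) {u : Fin n}
    (hu : u ∈ firstEntries σ (i + 1)) : u ≤ rankTuple R σ i := by
  have h := card_rankTuple_lt hσ R i
  rw [hi, show (i : ℕ) + 1 - i - 1 = 0 by omega, Finset.card_eq_zero,
    Finset.filter_eq_empty_iff] at h
  exact not_lt.1 (h hu)

lemma fullRankTuple_mem (i : Fin n) : fullRankTuple σ i ∈ firstEntries σ (i + 1) :=
  carrelEnd_Icc i ▸ rankTuple_mem hσ (Finset.Icc 1 (n - 1)) i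

lemma isUpperFlag_fullRankTuple : IsUpperFlag (fullRankTuple σ) := by
  refine ⟨fun i j hij => le_rankTuple_of_last hσ (carrelEnd_Icc j) ?_, isUpper_rankTuple hσ _⟩
  exact firstEntries_subset σ (Nat.succ_le_succ hij) (fullRankTuple_mem hσ i)

/-- The full rank tuple records prefix maxima. If the first `i + 1` entries were all smaller than
the entry of the rank `R`-tuple, that entry would have rank at least `i + 2` from below. -/
lemma rankTuple_le_fullRankTuple : rankTuple R σ i ≤ fullRankTuple σ i := by
  by_contra! hlt
  have h := Finset.card_lt_card (s := firstEntries σ (i + 1))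
    (t := (firstEntries σ (carrelEnd R i)).filter (fun u => u ≤ rankTuple R σ i))
    ⟨fun u hu => Finset.mem_filter.2 ⟨firstEntries_subset σ (carrelEnd_mem R i).2 hu,
      (le_rankTuple_of_last hσ (carrelEnd_Icc i) hu).trans hlt.le⟩, fun hs => ?_⟩
  · rw [card_le_rankTuple hσ, card_firstEntries hσ i.isLt] at h
    exact lt_irrefl _ h
  · exact absurd (le_rankTuple_of_last hσ (carrelEnd_Icc i)
      (hs (Finset.mem_filter.2 ⟨rankTuple_mem hσ R i, le_rfl⟩))) hlt.not_ge

end RankTuple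

/-- At the end of its carrel the entry is a prefix maximum and the inequality is clear. At any other
critical index `k` the value just above the entry is missing from the prefix up to the carrel end; a
larger entry at `x` would then produce an `R`-pattern by `exists_pattern`. -/
lemma isGapless_rankTuple {R : Finset ℕ} {π : Fin n → Fin n} (hπ : IsRPerm312 R π) :
    IsGapless R (rankTuple R π) := by
  have hp := hπ.1.1
  refine ⟨⟨isUpper_rankTuple hp R, ?_⟩, isRIncreasing_rankTuple hp R⟩
  intro x k hxR hxk hno hk _
  have hx : carrelEnd R x = (x : ℕ) + 1 :=
    le_antisymm (carrelEnd_le_of_mem R (Finset.mem_insert_of_mem hxR) (Nat.lt_succ_self _))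
      (carrelEnd_mem R x).2
  have hxm : rankTuple R π x ∈ firstEntries π (x + 1) := hx ▸ rankTuple_mem hp R x
  have hke := (carrelEnd_mem R k).2
  cases hk with
  | last _ h =>
    refine le_rankTuple_of_last hp h.symm (firstEntries_subset π ?_ hxm)
    have := Fin.lt_def.1 hxk
    omega
  | next y _ _ hky hs hjump hmax =>
    by_contra! hlt
    have hlt' := Fin.lt_def.1 hlt
    have hxk' := Fin.lt_def.1 hxk
    have hky' := Fin.lt_def.1 hky
    rw [sameCarrel_iff] at hs
    have hye := (carrelEnd_mem R y).2
    have hk1n : (k : ℕ) + 1 < n := lt_of_le_of_lt hky' y.isLt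
    set k' : Fin n := ⟨k + 1, hk1n⟩ with hk'
    have hk'e : carrelEnd R k = carrelEnd R k' :=
      carrelEnd_eq_of_lt (Fin.le_def.2 (by simp [hk'])) (by simp only [hk']; omega)
    -- There is a jump to `y` from `k` but none from `k + 1`, so the excess increase occurs between
    -- `k` and `k + 1`.
    have hgap : (rankTuple R π k : ℕ) + 1 < rankTuple R π k' := by
      rcases eq_or_lt_of_le (show (k' : ℕ) ≤ y from hky') with h | h
      · obtain rfl : k' = y := Fin.ext h
        simp only [Jump] at hjump
        have : (k' : ℕ) = k + 1 := rfl
        omega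
      · have h2 := hmax k' (Fin.lt_def.2 (by simp [hk'])) (Fin.lt_def.2 h)
        simp only [Jump] at h2 hjump
        have : (k' : ℕ) = k + 1 := rfl
        omega
    set w : Fin n := ⟨rankTuple R π k + 1, by have := (rankTuple R π x).isLt; omega⟩ with hwdef
    -- The entries at `k` and `k + 1` have consecutive ranks in the same prefix set, which leaves no
    -- room for `w` between them.
    have hw : w ∉ firstEntries π (carrelEnd R k) := by
      intro hmem
      have hsub : insert (rankTuple R π k') (insert w ((firstEntries π (carrelEnd R k)).filter
          (fun u => u ≤ rankTuple R π k))) ⊆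
          (firstEntries π (carrelEnd R k')).filter (fun u => u ≤ rankTuple R π k') := by
        intro u hu
        simp only [Finset.mem_insert, Finset.mem_filter] at hu ⊢
        rcases hu with rfl | rfl | ⟨hu, hu'⟩
        · exact ⟨rankTuple_mem hp R _, le_rfl⟩
        · exact ⟨hk'e ▸ hmem, Fin.le_def.2 hgap.le⟩
        · exact ⟨hk'e ▸ hu, hu'.trans (Fin.le_def.2 (by omega))⟩
      have hcard := Finset.card_le_card hsub
      rw [Finset.card_insert_of_notMem, Finset.card_insert_of_notMem, card_le_rankTuple hp,
        card_le_rankTuple hp] at hcard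
      · simp [hk'] at hcard
      · rw [Finset.mem_filter, Fin.le_def]
        exact fun h => absurd h.2 (Nat.not_succ_le_self _)
      · rw [Finset.mem_insert, Finset.mem_filter, Fin.le_def, Fin.ext_iff]
        have : (w : ℕ) = rankTuple R π k + 1 := rfl
        omega
    have hcount : (firstEntries π (carrelEnd R k)).filter (fun u => u < w) =
        (firstEntries π (carrelEnd R k)).filter (fun u => u ≤ rankTuple R π k) :=
      Finset.filter_congr fun u _ => Nat.lt_succ_iff
    obtain ⟨a, b, c, ha, hb, hb', hc, hpat⟩ := exists_pattern hp (q := x + 1) (by omega)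
      (carrelEnd_le R k) hw hxm (Fin.le_def.2 hlt') (by rw [hcount, card_le_rankTuple hp]; omega)
    refine hπ.2 ⟨x + 1, hxR, carrelEnd R k, ?_, by omega, ?_, a, b, c, ha, hb, hb', hc, hpat⟩
    · exact (Finset.mem_insert.1 (carrelEnd_mem R k).1).resolve_left (by have := c.isLt; omega)
    · rintro p hpR ⟨h1, h2⟩
      exact absurd (carrelEnd_le_of_mem R (Finset.mem_insert_of_mem hpR)
        (not_le.1 fun h => hno p hpR ⟨h1, h⟩)) h2.not_ge

/-- For a `312`-avoiding permutation the carrel of `i` has an index `k ≥ i` whose prefix maximum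
exceeds the entry `i` of the rank tuple by at most `k - i`. -/
lemma exists_fullRankTuple_le {σ : Fin n → Fin n} (hσ : IsPerm312 σ) (R : Finset ℕ) (i : Fin n) :
    ∃ k : Fin n, i ≤ k ∧ (k : ℕ) < carrelEnd R i ∧
      (fullRankTuple σ k : ℕ) + i ≤ rankTuple R σ i + k := by
  classical
  have hp := hσ.1
  set B := firstEntries σ (carrelEnd R i) with hB
  set m := rankTuple R σ i with hm
  -- the first value above `m` that is missing from `B`
  have hex : ∃ t : ℕ, ∀ u ∈ B, (u : ℕ) ≠ m + 1 + t := ⟨n, fun u _ => by have := u.isLt; omega⟩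
  set t := Nat.find hex with ht
  have hspec := Nat.find_spec hex
  have hmin : ∀ s < t, ∃ u ∈ B, (u : ℕ) = m + 1 + s := fun s hs => by
    have := Nat.find_min hex hs
    push Not at this
    exact this
  -- There are `i + 1` elements up to `m`, followed by the unbroken run of `t` values after `m`.
  have hcount : (B.filter (fun u : Fin n => (u : ℕ) < m + 1 + t)).card = i + 1 + t := by
    have hdisj : Disjoint (Finset.range (m + 1)) (Finset.Ico (m + 1 : ℕ) (m + 1 + t)) := by
      rw [Finset.disjoint_left]
      intro a ha hb
      rw [Finset.mem_range] at ha
      rw [Finset.mem_Ico] at hb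
      omega
    have himg : (B.filter (fun u : Fin n => (u : ℕ) < m + 1 + t)).map Fin.valEmbedding =
        (B.filter (fun u => u ≤ m)).map Fin.valEmbedding ∪
          Finset.Ico ((m : ℕ) + 1) (m + 1 + t) := by
      ext s
      simp only [Finset.mem_map, Finset.mem_filter, Finset.mem_union, Finset.mem_Ico,
        Fin.valEmbedding_apply, Fin.le_def]
      constructor
      · rintro ⟨u, ⟨hu, hlt⟩, rfl⟩
        rcases le_or_gt (u : ℕ) m with h | h
        · exact Or.inl ⟨u, ⟨hu, h⟩, rfl⟩
        · exact Or.inr ⟨h, hlt⟩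
      · rintro (⟨u, ⟨hu, hle⟩, rfl⟩ | ⟨h1, h2⟩)
        · exact ⟨u, ⟨hu, by omega⟩, rfl⟩
        · obtain ⟨u, hu, hus⟩ := hmin (s - (m + 1)) (by omega)
          exact ⟨u, ⟨hu, by omega⟩, by omega⟩
    rw [← Finset.card_map Fin.valEmbedding, himg, Finset.card_union_of_disjoint, Finset.card_map,
      card_le_rankTuple hp, Nat.card_Ico]
    · omega
    · rw [Finset.disjoint_left]
      intro a ha hb
      simp only [Finset.mem_map, Finset.mem_filter, Fin.valEmbedding_apply, Fin.le_def,
        Finset.mem_Ico] at ha hb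
      obtain ⟨u, ⟨-, hu⟩, rfl⟩ := ha
      omega
  have hle : (i : ℕ) + 1 + t ≤ carrelEnd R i := by
    rw [← hcount, ← card_firstEntries hp (carrelEnd_le R i)]
    exact Finset.card_filter_le _ _
  have hen := carrelEnd_le R i
  -- This choice makes the number of elements of `B` below the missing value `m + 1 + t` equal to `k
  -- + 1`. A prefix maximum at `k` above `m + t` then satisfies the count in `exists_pattern` with
  -- `q = k + 1`.
  set k : Fin n := ⟨i + t, by omega⟩ with hk
  refine ⟨k, Fin.le_def.2 (by simp [hk]), by simp only [hk]; omega, ?_⟩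
  by_contra! hlt
  have hφ := fullRankTuple_mem hp k
  have hkv : (k : ℕ) = i + t := rfl
  have hφn := (fullRankTuple σ k).isLt
  set w : Fin n := ⟨m + 1 + t, by omega⟩ with hw
  obtain ⟨a, b, c, ha, hb, hb', hc, hpat⟩ := exists_pattern hp (q := (k : ℕ) + 1) (w := w)
    (by omega) hen (fun h => hspec w h rfl) hφ
    (Fin.le_def.2 (by simp only [hw]; omega))
    (by
      have : B.filter (fun u => u < w) = B.filter (fun u : Fin n => (u : ℕ) < m + 1 + t) :=
        Finset.filter_congr fun u _ => by simp [hw, Fin.lt_def]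
      rw [← hB, this, hcount]
      omega)
  exact hσ.2 ⟨a, b, c, Fin.lt_def.2 (by omega), Fin.lt_def.2 (by omega), hpat⟩

/-! ### Shapes -/

section Shapes

variable {lam : Fin n → ℕ}

lemma colLen_mem {i : Fin n} {j : ℕ} (hj : j < lam i) :
    colLen lam j ∈ insert n (dividers lam) := by
  have hle : colLen lam j ≤ n := (Finset.card_filter_le _ _).trans (by simp)
  rcases hle.eq_or_lt with h | h
  · exact Finset.mem_insert.2 (Or.inl h)
  · refine Finset.mem_insert_of_mem (Finset.mem_filter.2 ⟨Finset.mem_image_of_mem _ ?_, h⟩)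
    exact Finset.mem_range.2 (hj.trans_le (Finset.le_sup (Finset.mem_univ i)))

lemma lt_colLen_iff (hlam : Antitone lam) {i : Fin n} {j : ℕ} :
    (i : ℕ) < colLen lam j ↔ j < lam i := by
  constructor
  · intro h
    by_contra! hle
    have := Finset.card_le_card (s := Finset.univ.filter (fun k => j < lam k))
      (t := Finset.Iio i) (fun k hk => by
        rw [Finset.mem_filter] at hk
        exact Finset.mem_Iio.2 (not_le.1 fun h' => absurd ((hlam h').trans hle) hk.2.not_ge))
    rw [Fin.card_Iio] at this
    exact absurd h this.not_gt
  · intro h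
    have := Finset.card_le_card (s := Finset.Iic i)
      (t := Finset.univ.filter (fun k => j < lam k)) (fun k hk => by
        exact Finset.mem_filter.2 ⟨Finset.mem_univ _, h.trans_le (hlam (Finset.mem_Iic.1 hk))⟩)
    rw [Fin.card_Iic] at this
    exact this

/-- The rows of a carrel have the same length. -/
lemma lt_lam_of_lt_carrelEnd (hlam : Antitone lam) {i k : Fin n} {j : ℕ} (hj : j < lam i)
    (hk : (k : ℕ) < carrelEnd (dividers lam) i) : j < lam k :=
  (lt_colLen_iff hlam).1
    (hk.trans_le (carrelEnd_le_of_mem _ (colLen_mem hj) ((lt_colLen_iff hlam).2 hj)))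

lemma IsTableau.add_le {T : Filling lam} (hT : IsTableau T) (hlam : Antitone lam) {j : ℕ} :
    ∀ (d : ℕ) (i k : Fin n), (k : ℕ) = i + d → ∀ (hi : j < lam i) (hk : j < lam k),
      (T i ⟨j, hi⟩ : ℕ) + d ≤ T k ⟨j, hk⟩
  | 0, i, k, hik, hi, hk => by
    obtain rfl : k = i := Fin.ext hik
    exact le_rfl
  | d + 1, i, k, hik, hi, hk => by
    have hl : (i : ℕ) + d < n := by have := k.isLt; omega
    have hlk : (⟨i + d, hl⟩ : Fin n) < k := Fin.lt_def.2 (by simp only; omega)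
    have hjl : j < lam ⟨i + d, hl⟩ := hk.trans_le (hlam hlk.le)
    have h1 := hT.add_le hlam d i ⟨i + d, hl⟩ rfl hi hjl
    have h2 := Fin.lt_def.1 (hT.2 ⟨i + d, hl⟩ k ⟨j, hjl⟩ ⟨j, hk⟩ hlk rfl)
    omega

/-- The full rank tuple may have larger entries, but strict columns pull the bound at a suitable
lower row of the carrel up to row `i`, losing one unit per row. That row exists in every column
meeting row `i`. -/
lemma rowBoundSet_fullRankTuple (hlam : Antitone lam) {σ : Fin n → Fin n} (hσ : IsPerm312 σ) :
    rowBoundSet lam (fullRankTuple σ) = rowBoundSet lam (rankTuple (dividers lam) σ) := by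
  refine Finset.filter_congr fun T _ => and_congr_right fun hT => ?_
  refine ⟨fun h => ⟨isUpper_rankTuple hσ.1 _, fun i j => ?_⟩,
    fun h => ⟨isUpper_rankTuple hσ.1 _, fun i j =>
      (h.2 i j).trans (rankTuple_le_fullRankTuple hσ.1)⟩⟩
  obtain ⟨k, hik, hke, hle⟩ := exists_fullRankTuple_le hσ (dividers lam) i
  have hjk := lt_lam_of_lt_carrelEnd hlam j.isLt hke
  have hik' := Fin.le_def.1 hik
  have h1 := hT.add_le hlam (k - i) i k (by omega) j.isLt hjk
  have h2 := Fin.le_def.1 (h.2 k ⟨j, hjk⟩)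
  exact Fin.le_def.2 (by simp only [Fin.eta] at h1; omega)

lemma rowBoundSum_fullRankTuple (hlam : Antitone lam) {σ : Fin n → Fin n} (hσ : IsPerm312 σ) :
    rowBoundSum lam (fullRankTuple σ) =
      rowBoundSum lam (rankTuple (dividers lam) (rProj (dividers lam) σ)) := by
  obtain ⟨τ, hτ, heq, -⟩ := exists_rProj_eq_comp (dividers lam) hσ.1
  rw [heq, rankTuple_comp hτ, rowBoundSum, rowBoundSet_fullRankTuple hlam hσ, rowBoundSum]

lemma demazurePoly_rProj {σ : Fin n → Fin n} (hσ : IsPerm σ) :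
    demazurePoly lam σ = demazurePoly lam (rProj (dividers lam) σ) := by
  obtain ⟨τ, hτ, heq, -⟩ := exists_rProj_eq_comp (dividers lam) hσ
  have hkey : key lam (σ ∘ τ) = key lam σ := by
    funext i j
    -- Only prefixes whose length is a column length enter the key, and these end at dividers or at
    -- `n`.
    simp only [key, firstEntries_comp hτ σ (colLen_mem j.isLt)]
  rw [heq, demazurePoly, demazurePoly, demazureSet, demazureSet, hkey]

end Shapes

end FlagDemazure

theorem theorem12p3 (n : ℕ) (hn : 1 ≤ n) (lam : Fin n → ℕ) (hlam : Antitone lam) :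
    (FlagDemazure.PostnikovStanley lam ↔ FlagDemazure.ParabolicCoincidence lam) ∧
    (∀ σ : Fin n → Fin n, FlagDemazure.IsPerm312 σ →
      FlagDemazure.IsRPerm312 (FlagDemazure.dividers lam)
        (FlagDemazure.rProj (FlagDemazure.dividers lam) σ) ∧
      FlagDemazure.demazurePoly lam σ =
        FlagDemazure.demazurePoly lam (FlagDemazure.rProj (FlagDemazure.dividers lam) σ) ∧
      FlagDemazure.rowBoundSum lam (FlagDemazure.fullRankTuple σ) =
        FlagDemazure.rowBoundSum lam (FlagDemazure.rankTuple (FlagDemazure.dividers lam)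
          (FlagDemazure.rProj (FlagDemazure.dividers lam) σ))) ∧
    (∀ π : Fin n → Fin n, FlagDemazure.IsRPerm312 (FlagDemazure.dividers lam) π →
      ∃ σ : Fin n → Fin n, FlagDemazure.IsPerm312 σ ∧
        FlagDemazure.rProj (FlagDemazure.dividers lam) σ = π) := by
  have hkey := fun (σ : Fin n → Fin n) (hσ : FlagDemazure.IsPerm312 σ) =>
    And.intro (FlagDemazure.isRPerm312_rProj (FlagDemazure.dividers lam) hσ)
      (And.intro (FlagDemazure.demazurePoly_rProj (lam := lam) hσ.1)
        (FlagDemazure.rowBoundSum_fullRankTuple hlam hσ))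
  refine ⟨⟨fun hA π hπ => ⟨FlagDemazure.isGapless_rankTuple hπ, ?_⟩, fun hB σ hσ =>
    ⟨FlagDemazure.isUpperFlag_fullRankTuple hσ.1, ?_⟩⟩, hkey,
    fun π hπ => FlagDemazure.exists_isPerm312_rProj_eq hπ⟩
  · obtain ⟨σ, hσ, rfl⟩ := FlagDemazure.exists_isPerm312_rProj_eq hπ
    obtain ⟨-, hd, hs⟩ := hkey σ hσ
    rw [← hd, ← hs]
    exact (hA σ hσ).2
  · obtain ⟨hp, hd, hs⟩ := hkey σ hσ
    rw [hd, hs]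
    exact (hB _ hp).2
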